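/- Let $G$ be a compact topological group (not assumed Hausdorff) with identity $1$ and let $X$ be a topological space. Let $\eta\colon G*X\to X$, $(g,x)\mapsto g\cdot x$, be a partial action of $G$ on $X$, that is, a function defined on a subset $G*X\subseteq G\times X$ such that for all $g,h\in G$ and $x\in X$, writing $\exists\, g\cdot x$ for $(g,x)\in G*X$: - if $\exists\, g\cdot x$, then $\exists\, g^{-1}\cdot(g\cdot x)$ and $g^{-1}\cdot(g\cdot x)=x$; - if $\exists\, h\cdot x$ and $\exists\, g\cdot(h\cdot x)$, then $\exists\, (gh)\cdot x$ and $g\cdot(h\cdot x)=(gh)\cdot x$; - $\exists\, 1\cdot x$ and $1\cdot x=x$. Assume that $\eta$ is continuous, where $G*X$ carries the subspace topology of the product $G\times X$, and topological: for every $g\in G$ the set $X_g=\{x\in X : \exists\, g^{-1}\cdot x\}$ is open in $X$ and the map $X_{g^{-1}}\to X_g$, $x\mapsto g\cdot x$, is a homeomorphism. Assume moreover that $G*X$ is closed in $G\times X$. Let $X/\!\sim_G$ be the quotient space of $X$ by the equivalence relation $x\sim_G y\iff$ there is $g\in G$ such that $\exists\, g\cdot x$ and $g\cdot x=y$. Let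 $X_G$ be the enveloping space, i.e. the quotient space of $G\times X$ by the equivalence relation $(g,x)\,R\,(h,y)\iff \exists\,(h^{-1}g)\cdot x$ and $(h^{-1}g)\cdot x=y$. Let $\mathcal P$ be any one of the following properties of topological spaces: Hausdorff; regular (either in the sense that a closed set and a point outside it have disjoint neighbourhoods, or in the sense that in addition the space is Hausdorff); metrizable; second countable. Then: (i) if $X$ has $\mathcal P$, then $X/\!\sim_G$ has $\mathcal P$; (ii) if $G\times X$ has $\mathcal P$, then $X_G$ has $\mathcal P$. -/

import Mathlib

/-- A partial action of a group `G` on a set `X`: a function `(g, x) ↦ g · x` defined on a subset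
`dom` (written `G * X`) of `G × X` and subject to (PA1), (PA2), (PA3). -/
structure PartialAction (G : Type*) (X : Type*) [Group G] where
  /-- The domain `G * X`; `(g, x) ∈ dom` means that `g · x` exists. -/
  dom : Set (G × X)
  /-- The value `g · x`, for `(g, x)` in the domain. -/
  act : ∀ (g : G) (x : X), (g, x) ∈ dom → X
  /-- (PA1), existence. -/
  inv_mem : ∀ (g : G) (x : X) (h : (g, x) ∈ dom), (g⁻¹, act g x h) ∈ dom
  /-- (PA1), value. -/
  inv_act : ∀ (g : G) (x : X) (h : (g, x) ∈ dom), act g⁻¹ (act g x h) (inv_mem g x h) = x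
  /-- (PA2), existence. -/
  mul_mem : ∀ (g k : G) (x : X) (hk : (k, x) ∈ dom), (g, act k x hk) ∈ dom → (g * k, x) ∈ dom
  /-- (PA2), value. -/
  act_act : ∀ (g k : G) (x : X) (hk : (k, x) ∈ dom) (hg : (g, act k x hk) ∈ dom),
    act g (act k x hk) hg = act (g * k) x (mul_mem g k x hk hg)
  /-- (PA3), existence. -/
  one_mem : ∀ x : X, (1, x) ∈ dom
  /-- (PA3), value. -/
  one_act : ∀ x : X, act 1 x (one_mem x) = x

namespace PartialAction

variable {G : Type*} {X : Type*} [Group G] (η : PartialAction G X)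

theorem act_congr {g k : G} {x y : X} (hgk : g = k) (hxy : x = y) (h : (g, x) ∈ η.dom) :
    η.act g x h = η.act k y (hgk ▸ hxy ▸ h) := by
  subst hgk; subst hxy; rfl

/-- The set `X_g` of all `x` for which `g⁻¹ · x` exists. -/
def domAt (g : G) : Set X := {x | (g⁻¹, x) ∈ η.dom}

/-- The map `η_g : X_{g⁻¹} → X_g`, `x ↦ g · x`. -/
def mapAt (g : G) (x : η.domAt g⁻¹) : η.domAt g :=
  have h : (g, (x : X)) ∈ η.dom := by simpa [domAt] using x.2
  ⟨η.act g x h, η.inv_mem g x h⟩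

/-- The partial action is continuous (as a map `G * X → X`, where `G * X` has the subspace topology
of `G × X`) and topological (every `X_g` is open and every `η_g : X_{g⁻¹} → X_g` is a
homeomorphism). -/
structure IsContinuousTopological [TopologicalSpace G] [TopologicalSpace X] : Prop where
  continuous_act : Continuous fun p : η.dom => η.act p.1.1 p.1.2 p.2
  isOpen_domAt : ∀ g : G, IsOpen (η.domAt g)
  isHomeomorph_mapAt : ∀ g : G, IsHomeomorph (η.mapAt g)

/-- The orbit equivalence relation: `x ∼ y` iff `g · x` exists and equals `y` for some `g`. -/
def orbitSetoid : Setoid X where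
  r x y := ∃ (g : G) (h : (g, x) ∈ η.dom), η.act g x h = y
  iseqv :=
    { refl := fun x => ⟨1, η.one_mem x, η.one_act x⟩
      symm := by
        rintro x _ ⟨g, h, rfl⟩
        exact ⟨g⁻¹, η.inv_mem g x h, η.inv_act g x h⟩
      trans := by
        rintro x _ _ ⟨g, h, rfl⟩ ⟨k, hk, rfl⟩
        exact ⟨k * g, η.mul_mem k g x h hk, (η.act_act k g x h hk).symm⟩ }

/-- The orbit space `X/∼_G`, which carries the quotient topology of `X`. -/
abbrev OrbitSpace : Type _ := Quotient η.orbitSetoid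

/-- The relation `R` on `G × X`: `(g, x) R (k, y)` iff `(k⁻¹ g) · x` exists and equals `y`. -/
def envelopingSetoid : Setoid (G × X) where
  r p q := ∃ h : (q.1⁻¹ * p.1, p.2) ∈ η.dom, η.act (q.1⁻¹ * p.1) p.2 h = q.2
  iseqv :=
    { refl := by
        rintro ⟨g, x⟩
        have e : (1 : G) = g⁻¹ * g := by group
        exact ⟨e ▸ η.one_mem x, ((η.act_congr e rfl (η.one_mem x)).symm.trans (η.one_act x))⟩
      symm := by
        rintro ⟨g, x⟩ ⟨k, y⟩ ⟨h, hy⟩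
        dsimp only at h hy
        subst hy
        have e : (k⁻¹ * g)⁻¹ = g⁻¹ * k := by group
        exact ⟨e ▸ η.inv_mem _ x h,
          (η.act_congr e rfl (η.inv_mem _ x h)).symm.trans (η.inv_act _ x h)⟩
      trans := by
        rintro ⟨g, x⟩ ⟨k, y⟩ ⟨l, z⟩ ⟨h, hy⟩ ⟨h', hz⟩
        dsimp only at h hy h' hz
        subst hy hz
        have e : l⁻¹ * k * (k⁻¹ * g) = l⁻¹ * g := by group
        exact ⟨e ▸ η.mul_mem _ _ x h h',
          ((η.act_act _ _ x h h').trans (η.act_congr e rfl (η.mul_mem _ _ x h h'))).symm⟩ }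

/-- The enveloping space `X_G = (G × X)/R`, which carries the quotient topology of `G × X`. -/
abbrev EnvelopingSpace : Type _ := Quotient η.envelopingSetoid

end PartialAction

/-! The quotient map `X → X/∼_G` is open because the sets `X_g` are open, closed because `G` is
compact and `G * X` is closed, and its fibres, the orbits, are compact. For such a map, `y ↦ f ⁻¹'
{y}` embeds the quotient into `NonemptyCompacts X` with the Vietoris topology
(`isEmbedding_fiberNonemptyCompacts`). Each of the properties passes from `X` to `NonemptyCompacts
X` and from there to subspaces, which gives (i). Part (ii) is (i) for a partial action on `G × X`
whose orbit relation is `R` (`prodAction`, `orbitSetoid_prodAction`). -/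

open Topology TopologicalSpace Set

section FiberMap

variable {X Y : Type*} [TopologicalSpace X] [TopologicalSpace Y] {f : X → Y}

/-- The fibres of a surjection with compact fibres, as nonempty compact sets. -/
def fiberNonemptyCompacts (f : X → Y) (hsurj : Function.Surjective f)
    (hcomp : ∀ y, IsCompact (f ⁻¹' {y})) (y : Y) : NonemptyCompacts X where
  carrier := f ⁻¹' {y}
  isCompact' := hcomp y
  nonempty' := hsurj y

/-- For an open and closed continuous surjection with compact fibres, sending a point to its fibre
embeds the codomain into the nonempty compact sets of the domain with the Vietoris topology. -/
theorem isEmbedding_fiberNonemptyCompacts (hcont : Continuous f) (hopen : IsOpenMap f)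
    (hclosed : IsClosedMap f) (hsurj : Function.Surjective f)
    (hcomp : ∀ y, IsCompact (f ⁻¹' {y})) :
    IsEmbedding (fiberNonemptyCompacts f hsurj hcomp) := by
  -- Through this identity, closedness of `f` handles open `U` and openness of `f` handles closed
  -- `U`, the two conditions for Vietoris continuity.
  have hpre (U : Set X) : {y | f ⁻¹' {y} ⊆ U} = (f '' Uᶜ)ᶜ := by
    ext y
    simp only [mem_ofPred_eq, mem_compl_iff, mem_image, not_exists, not_and, subset_def,
      mem_preimage, mem_singleton_iff]
    exact forall_congr' fun x => by tauto
  have hc : Continuous (fiberNonemptyCompacts f hsurj hcomp) := by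
    let : TopologicalSpace (Set X) := .vietoris X
    rw [NonemptyCompacts.isEmbedding_coe.continuous_iff, vietoris.continuous_iff]
    refine ⟨fun U hU => ?_, fun F hF => ?_⟩
    · change IsOpen {y | f ⁻¹' {y} ⊆ U}
      rw [hpre]
      exact (hclosed _ hU.isClosed_compl).isOpen_compl
    · change IsClosed {y | f ⁻¹' {y} ⊆ F}
      rw [hpre]
      exact (hopen _ hF.isOpen_compl).isClosed_compl
  refine ⟨⟨le_antisymm hc.le_induced fun U hU => ?_⟩, fun y z h => ?_⟩
  -- By surjectivity, a fibre lies in `f ⁻¹' U` only if its base point lies in `U`, so `U` is pulled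
  -- back from a Vietoris open set.
  · refine ⟨{K | (K : Set X) ⊆ f ⁻¹' U},
      NonemptyCompacts.isOpen_subsets_of_isOpen (hU.preimage hcont), ?_⟩
    ext y
    change f ⁻¹' {y} ⊆ f ⁻¹' U ↔ y ∈ U
    rw [hsurj.preimage_subset_preimage_iff, singleton_subset_iff]
  · have h' : f ⁻¹' {y} = f ⁻¹' {z} := congrArg (fun K : NonemptyCompacts X => (K : Set X)) h
    simpa using hsurj.preimage_injective h'

end FiberMap

namespace PartialAction

variable {G X : Type*} [Group G] (η : PartialAction G X)

/-- The partial action `k · (g, x) = (g k⁻¹, k · x)` on `G × X`, whose orbits are the classes of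
`PartialAction.envelopingSetoid`. -/
def prodAction : PartialAction G (G × X) where
  dom := {p | (p.1, p.2.2) ∈ η.dom}
  act k p h := (p.1 * k⁻¹, η.act k p.2 h)
  inv_mem k p h := η.inv_mem k p.2 h
  inv_act k p h := Prod.ext (by simp) (η.inv_act k p.2 h)
  mul_mem k l p hl hk := η.mul_mem k l p.2 hl hk
  act_act k l p hl hk := Prod.ext (by simp [mul_assoc]) (η.act_act k l p.2 hl hk)
  one_mem p := η.one_mem p.2
  one_act p := Prod.ext (by simp) (η.one_act p.2)

/-- The equation `g * l⁻¹ = k` in the first coordinate forces `l = k⁻¹ * g`, the element that occurs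
in `R`. -/
theorem orbitSetoid_prodAction : η.prodAction.orbitSetoid = η.envelopingSetoid := by
  ext ⟨g, x⟩ ⟨k, y⟩
  constructor
  · rintro ⟨l, h, e⟩
    obtain ⟨rfl, rfl⟩ := Prod.mk.inj e
    have hl : l = (g * l⁻¹)⁻¹ * g := by group
    have h' : (l, x) ∈ η.dom := h
    exact ⟨hl ▸ h', (η.act_congr hl rfl h').symm⟩
  · rintro ⟨h, e⟩
    exact ⟨k⁻¹ * g, h, Prod.ext (by simp [prodAction]) e⟩

variable {η} in
theorem mk_eq_mk_iff {x y : X} :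
    (⟦x⟧ : η.OrbitSpace) = ⟦y⟧ ↔ ∃ (g : G) (h : (g, x) ∈ η.dom), η.act g x h = y :=
  Quotient.eq

variable {η} in
theorem preimage_image_mk (s : Set X) :
    (Quotient.mk η.orbitSetoid) ⁻¹' (Quotient.mk η.orbitSetoid '' s) =
      {x | ∃ (g : G) (h : (g, x) ∈ η.dom), η.act g x h ∈ s} := by
  ext x
  constructor
  · rintro ⟨y, hy, e⟩
    obtain ⟨g, h, rfl⟩ := mk_eq_mk_iff.1 e.symm
    exact ⟨g, h, hy⟩
  · rintro ⟨g, h, hs⟩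
    exact ⟨_, hs, (mk_eq_mk_iff.2 ⟨g, h, rfl⟩).symm⟩

variable [TopologicalSpace G] [TopologicalSpace X]

theorem isClosed_dom_prodAction (hclosed : IsClosed η.dom) : IsClosed η.prodAction.dom :=
  hclosed.preimage (f := fun p : G × G × X => (p.1, p.2.2)) (by fun_prop)

variable {η}

theorem IsContinuousTopological.continuous_act_left (hη : η.IsContinuousTopological) (g : G) :
    Continuous fun x : {x // (g, x) ∈ η.dom} => η.act g x x.2 :=
  hη.continuous_act.comp (Continuous.subtype_mk (f := fun x : {x // (g, x) ∈ η.dom} => (g, x.1))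
    (by fun_prop) fun x => x.2)

theorem IsContinuousTopological.isOpen_setOf_mem_dom (hη : η.IsContinuousTopological) (g : G) :
    IsOpen {x | (g, x) ∈ η.dom} := by
  simpa [domAt] using hη.isOpen_domAt g⁻¹

theorem continuous_mapAt (hη : Continuous fun p : η.dom => η.act p.1.1 p.1.2 p.2) (g : G) :
    Continuous (η.mapAt g) :=
  Continuous.subtype_mk (hη.comp (Continuous.subtype_mk
    (f := fun x : η.domAt g⁻¹ => (g, x.1)) (by fun_prop)
    fun x => by simpa [domAt] using x.2)) _

/-- A continuous partial action with open domains is topological. -/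
theorem IsContinuousTopological.of_continuous
    (hη : Continuous fun p : η.dom => η.act p.1.1 p.1.2 p.2)
    (hopen : ∀ g, IsOpen (η.domAt g)) : η.IsContinuousTopological where
  continuous_act := hη
  isOpen_domAt := hopen
  isHomeomorph_mapAt g := by
    rw [isHomeomorph_iff_exists_inverse]
    refine ⟨continuous_mapAt hη g,
      fun x => ⟨η.act g⁻¹ x x.2, by simpa [domAt] using η.inv_mem _ _ x.2⟩, ?_, ?_, ?_⟩
    · intro x
      exact Subtype.ext (η.inv_act g x (by simpa [domAt] using x.2))
    · intro x
      refine Subtype.ext ?_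
      exact (η.act_congr (inv_inv g).symm rfl _).trans (η.inv_act g⁻¹ x x.2)
    · exact Continuous.subtype_mk (hη.comp (Continuous.subtype_mk
        (f := fun x : η.domAt g => (g⁻¹, x.1)) (by fun_prop) fun x => x.2)) _

theorem IsContinuousTopological.prodAction [IsTopologicalGroup G]
    (hη : η.IsContinuousTopological) : η.prodAction.IsContinuousTopological := by
  refine .of_continuous ?_ fun g => (hη.isOpen_domAt g).preimage continuous_snd
  refine Continuous.prodMk (f := fun p : η.prodAction.dom => p.1.2.1 * p.1.1⁻¹) (by fun_prop) ?_
  exact hη.continuous_act.comp (Continuous.subtype_mk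
    (f := fun p : η.prodAction.dom => (p.1.1, p.1.2.2)) (by fun_prop) fun p => p.2)

/-- The saturation of `U` is the union over `g` of the sets `{x | g · x ∈ U}`, each open in an open
domain. -/
theorem IsContinuousTopological.isOpenMap_mk (hη : η.IsContinuousTopological) :
    IsOpenMap (Quotient.mk η.orbitSetoid) := by
  intro U hU
  rw [← (isQuotientMap_quotient_mk' (s := η.orbitSetoid)).isOpen_preimage]
  change IsOpen (Quotient.mk η.orbitSetoid ⁻¹' _)
  rw [preimage_image_mk]
  have : {x | ∃ (g : G) (h : (g, x) ∈ η.dom), η.act g x h ∈ U} =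
      ⋃ g : G, Subtype.val '' ((fun x : {x // (g, x) ∈ η.dom} => η.act g x x.2) ⁻¹' U) := by
    ext x
    simp
  rw [this]
  exact isOpen_iUnion fun g => (hη.isOpen_setOf_mem_dom g).isOpenMap_subtype_val _
    (hU.preimage (hη.continuous_act_left g))

/-- The saturation of `C` is the projection of `{(g, x) | g · x ∈ C}`, which is closed in `G * X`
and hence in `G × X`; projecting along the compact factor `G` preserves closedness. -/
theorem IsContinuousTopological.isClosedMap_mk [CompactSpace G]
    (hη : η.IsContinuousTopological) (hclosed : IsClosed η.dom) :
    IsClosedMap (Quotient.mk η.orbitSetoid) := by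
  intro C hC
  rw [← (isQuotientMap_quotient_mk' (s := η.orbitSetoid)).isClosed_preimage]
  change IsClosed (Quotient.mk η.orbitSetoid ⁻¹' _)
  rw [preimage_image_mk]
  have : {x | ∃ (g : G) (h : (g, x) ∈ η.dom), η.act g x h ∈ C} = Prod.snd ''
      (Subtype.val '' ((fun p : η.dom => η.act p.1.1 p.1.2 p.2) ⁻¹' C)) := by
    ext x
    simp
  rw [this]
  exact isClosedMap_snd_of_compactSpace _
    (hclosed.isClosedMap_subtype_val _ (hC.preimage hη.continuous_act))

/-- The orbit of `x` is the continuous image of `{g | (g, x) ∈ η.dom}`, a closed subset of the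
compact group. -/
theorem IsContinuousTopological.isCompact_fiber_mk [CompactSpace G]
    (hη : η.IsContinuousTopological) (hclosed : IsClosed η.dom) (y : η.OrbitSpace) :
    IsCompact (Quotient.mk η.orbitSetoid ⁻¹' {y}) := by
  obtain ⟨x, rfl⟩ := Quotient.exists_rep y
  have hcl : IsClosed {g | (g, x) ∈ η.dom} :=
    hclosed.preimage (f := fun g : G => (g, x)) (by fun_prop)
  have : CompactSpace {g // (g, x) ∈ η.dom} := isCompact_iff_compactSpace.1 hcl.isCompact
  have hc : Continuous fun g : {g // (g, x) ∈ η.dom} => η.act g x g.2 :=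
    hη.continuous_act.comp (Continuous.subtype_mk
      (f := fun g : {g // (g, x) ∈ η.dom} => (g.1, x)) (by fun_prop) fun g => g.2)
  convert isCompact_range hc
  ext z
  rw [mem_preimage, mem_singleton_iff, eq_comm, mk_eq_mk_iff]
  simp

/-- The orbit space embeds into the space of nonempty compact subsets of `X`. -/
theorem IsContinuousTopological.exists_isEmbedding [CompactSpace G]
    (hη : η.IsContinuousTopological) (hclosed : IsClosed η.dom) :
    ∃ f : η.OrbitSpace → NonemptyCompacts X, IsEmbedding f :=
  ⟨_, isEmbedding_fiberNonemptyCompacts continuous_quotient_mk' hη.isOpenMap_mk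
    (hη.isClosedMap_mk hclosed) Quotient.mk_surjective (hη.isCompact_fiber_mk hclosed)⟩

theorem IsContinuousTopological.orbitSpace_properties [CompactSpace G]
    (hη : η.IsContinuousTopological) (hclosed : IsClosed η.dom) :
    (T2Space X → T2Space η.OrbitSpace) ∧
      (RegularSpace X → RegularSpace η.OrbitSpace) ∧
      (T3Space X → T3Space η.OrbitSpace) ∧
      (MetrizableSpace X → MetrizableSpace η.OrbitSpace) ∧
      (SecondCountableTopology X → SecondCountableTopology η.OrbitSpace) := by
  obtain ⟨f, hf⟩ := hη.exists_isEmbedding hclosed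
  refine ⟨fun _ => hf.t2Space, fun _ => hf.isInducing.regularSpace, fun _ => hf.t3Space,
    fun _ => ?_, fun _ => hf.secondCountableTopology⟩
  -- A compatible metric on `X` makes the Hausdorff metric available on `NonemptyCompacts X`.
  let := metrizableSpaceMetric X
  exact hf.metrizableSpace

end PartialAction


theorem theorem3p2 {G : Type*} {X : Type*} [Group G] [TopologicalSpace G] [IsTopologicalGroup G]
    [CompactSpace G] [TopologicalSpace X] (η : PartialAction G X)
    (hη : η.IsContinuousTopological) (hclosed : IsClosed η.dom) :
    ((T2Space X → T2Space η.OrbitSpace) ∧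
      (RegularSpace X → RegularSpace η.OrbitSpace) ∧
      (T3Space X → T3Space η.OrbitSpace) ∧
      (TopologicalSpace.MetrizableSpace X → TopologicalSpace.MetrizableSpace η.OrbitSpace) ∧
      (SecondCountableTopology X → SecondCountableTopology η.OrbitSpace)) ∧
    ((T2Space (G × X) → T2Space η.EnvelopingSpace) ∧
      (RegularSpace (G × X) → RegularSpace η.EnvelopingSpace) ∧
      (T3Space (G × X) → T3Space η.EnvelopingSpace) ∧
      (TopologicalSpace.MetrizableSpace (G × X) →
        TopologicalSpace.MetrizableSpace η.EnvelopingSpace) ∧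
      (SecondCountableTopology (G × X) → SecondCountableTopology η.EnvelopingSpace)) := by
  refine ⟨hη.orbitSpace_properties hclosed, ?_⟩
  have h := hη.prodAction.orbitSpace_properties (η.isClosed_dom_prodAction hclosed)
  unfold PartialAction.OrbitSpace at h
  rwa [η.orbitSetoid_prodAction] at h
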